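/- A graph $G$ on $n$ vertices is called a $\beta$-graph if every two disjoint vertex sets, each of size at least $\beta n$, are joined by an edge. There is an absolute constant $C>0$ such that for every $0<\beta<1/20$ there exist real numbers $b_1,b_2$, depending only on $\beta$, with $0<b_1\le C/\log(1/\beta)$, $0<b_2\le C\beta$ and $b_2<1$, such that for every $n$, every $\beta$-graph on $n$ vertices contains a cycle of length $\ell$ for every integer $\ell\ge 3$ with $b_1\log n\le \ell\le (1-b_2)n$. -/

import Mathlib

/-- A graph `G` on a finite vertex set `V` with `n = |V|` vertices is a `β`-graph if every two
disjoint vertex sets of size at least `β * n` are joined by an edge. -/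
def SimpleGraph.IsBetaGraph {V : Type*} [Fintype V] (G : SimpleGraph V) (β : ℝ) : Prop :=
  ∀ A B : Finset V, Disjoint A B →
    β * (Fintype.card V : ℝ) ≤ (A.card : ℝ) → β * (Fintype.card V : ℝ) ≤ (B.card : ℝ) →
    ∃ a ∈ A, ∃ b ∈ B, G.Adj a b

/-- `G` contains a cycle of length `l` (a cycle in Mathlib's sense, so of length at least 3). -/
def SimpleGraph.HasCycleOfLength {V : Type*} (G : SimpleGraph V) (l : ℕ) : Prop :=
  ∃ (v : V) (c : G.Walk v v), c.IsCycle ∧ c.length = l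

namespace SimpleGraph

variable {V : Type*} {G : SimpleGraph V}

/-! With `m = ⌈βn⌉`, any two disjoint `m`-sets are joined. Reserve two disjoint sets of `(3k+1)m`
vertices. Each contains a set in which small sets expand (`IsJoined.exists_expanding`), so each of
its vertices reaches `m` vertices by paths of one common length, at most `log_k m + 1`
(`exists_isReachedIn`). Outside the reserves, depth-first search yields a path of any desired order
whose ends have neighbours in both expanding sets. Trees grown from such neighbours have `m` leaves
each, so an edge joins the two leaf sets and closes a cycle. Tree depths do not depend on the roots,
so the length is exact. For small `β`, cycles shorter than `n/2` use `k` about `β^(-1/4)`, which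
makes the trees shallow; longer ones use `k = 2`, which keeps the reserves of size `O(βn)`. -/

/-- Any two disjoint vertex sets of size at least `m` are joined by an edge. -/
def IsJoined (G : SimpleGraph V) (m : ℕ) : Prop :=
  ∀ A B : Finset V, Disjoint A B → m ≤ A.card → m ≤ B.card → ∃ a ∈ A, ∃ b ∈ B, G.Adj a b

/-- There is a path of length `n` from `u` to `v` all of whose vertices lie in `S`. -/
def HasPathIn (G : SimpleGraph V) (S : Finset V) (n : ℕ) (u v : V) : Prop :=
  ∃ p : G.Walk u v, p.IsPath ∧ p.length = n ∧ ∀ x ∈ p.support, x ∈ S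

/-! ### Paths confined to vertex sets -/

namespace HasPathIn

variable {S T : Finset V} {n k : ℕ} {u v w z : V}

theorem refl (h : u ∈ S) : G.HasPathIn S 0 u u :=
  ⟨Walk.nil, by simp, rfl, by simpa using h⟩

theorem symm (h : G.HasPathIn S n u v) : G.HasPathIn S n v u := by
  obtain ⟨p, hp, hl, hs⟩ := h
  exact ⟨p.reverse, hp.reverse, by simpa using hl, fun x hx => hs x (by simpa using hx)⟩

theorem append [DecidableEq V] (h₁ : G.HasPathIn S n u v) (hvw : G.Adj v w)
    (h₂ : G.HasPathIn T k w z) (hST : Disjoint S T) :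
    G.HasPathIn (S ∪ T) (n + 1 + k) u z := by
  obtain ⟨p, hp, hpl, hps⟩ := h₁
  obtain ⟨q, hq, hql, hqs⟩ := h₂
  refine ⟨p.append (q.cons hvw), ?_, ?_, ?_⟩
  · rw [Walk.isPath_def, Walk.support_append, Walk.support_cons, List.tail_cons]
    refine List.Nodup.append hp.support_nodup hq.support_nodup fun x hx hx' => ?_
    exact Finset.disjoint_left.1 hST (hps x hx) (hqs x hx')
  · simp only [Walk.length_append, Walk.length_cons]
    omega
  · intro x hx
    rw [Walk.support_append, Walk.support_cons, List.tail_cons, List.mem_append] at hx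
    exact Finset.mem_union.2 (hx.imp (hps x) (hqs x))

theorem mono (h : G.HasPathIn S n u v) (hST : S ⊆ T) : G.HasPathIn T n u v := by
  obtain ⟨p, hp, hl, hs⟩ := h
  exact ⟨p, hp, hl, fun x hx => hST (hs x hx)⟩

theorem mem_left (h : G.HasPathIn S n u v) : u ∈ S := by
  obtain ⟨p, -, -, hs⟩ := h
  exact hs u p.start_mem_support

theorem mem_right (h : G.HasPathIn S n u v) : v ∈ S := h.symm.mem_left

theorem hasCycleOfLength (h : G.HasPathIn S n u v) (hvu : G.Adj v u) (hn : 2 ≤ n) :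
    G.HasCycleOfLength (n + 1) := by
  obtain ⟨p, hp, hl, -⟩ := h
  refine ⟨v, p.cons hvu, ?_, by simp [hl]⟩
  rw [Walk.isCycle_iff_isPath_tail_and_le_length]
  refine ⟨by simpa using hp, ?_⟩
  rw [Walk.length_cons]
  omega

end HasPathIn

/-! ### Long paths by depth-first search -/

/-- Depth-first search: the stack, together with the unexplored vertices `U` and the finished
vertices `D`, at the moment when `U` and `D` have equal size. -/
theorem exists_list_of_no_edges [DecidableEq V] (N : ℕ) :
    ∀ (U D : Finset V) (l : List V), 2 * U.card + l.length = N → l.Nodup → l.IsChain G.Adj →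
      Disjoint U D → (∀ x ∈ l, x ∉ U ∧ x ∉ D) → (∀ a ∈ U, ∀ b ∈ D, ¬ G.Adj a b) →
      D.card ≤ U.card →
      ∃ (U' D' : Finset V) (l' : List V), l'.Nodup ∧ l'.IsChain G.Adj ∧ Disjoint U' D' ∧
        (∀ x, x ∈ U' ∨ x ∈ D' ∨ x ∈ l' → x ∈ U ∨ x ∈ D ∨ x ∈ l) ∧
        (∀ a ∈ U', ∀ b ∈ D', ¬ G.Adj a b) ∧ U'.card = D'.card ∧
        U'.card + D'.card + l'.length = U.card + D.card + l.length := by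
  -- Pushing and popping each lower `2|U| + |l|` by one and `|U| - |D|` by one, so equality is
  -- reached.
  induction N using Nat.strong_induction_on with
  | _ N ih =>
    intro U D l hN hnd hch hUD hl hno hle
    rcases hle.eq_or_lt with heq | hlt
    · exact ⟨U, D, l, hnd, hch, hUD, fun _ h => h, hno, heq.symm, rfl⟩
    -- On an empty stack `head?` imposes no condition, so any vertex may be pushed.
    by_cases hpush : ∃ u ∈ U, ∀ x ∈ l.head?, G.Adj u x
    · obtain ⟨u, hu, hux⟩ := hpush
      have hc : (U.erase u).card + 1 = U.card := Finset.card_erase_add_one hu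
      obtain ⟨U', D', l', h1, h2, h3, h4, h5, h6, h7⟩ :=
        ih (2 * (U.erase u).card + (u :: l).length) (by simp only [List.length_cons]; omega)
          (U.erase u) D (u :: l) rfl
          (List.nodup_cons.2 ⟨fun h => (hl u h).1 hu, hnd⟩)
          (List.isChain_cons.2 ⟨hux, hch⟩)
          (hUD.mono_left (Finset.erase_subset _ _))
          (by
            intro x hx
            rcases List.mem_cons.1 hx with rfl | hx
            · exact ⟨by simp, Finset.disjoint_left.1 hUD hu⟩
            · exact ⟨fun h => (hl x hx).1 (Finset.mem_of_mem_erase h), (hl x hx).2⟩)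
          (fun a ha b hb => hno a (Finset.mem_of_mem_erase ha) b hb) (by omega)
      refine ⟨U', D', l', h1, h2, h3, fun x hx => ?_, h5, h6, ?_⟩
      · rcases h4 x hx with h | h | h
        · exact Or.inl (Finset.mem_of_mem_erase h)
        · exact Or.inr (Or.inl h)
        · rcases List.mem_cons.1 h with rfl | h
          · exact Or.inl hu
          · exact Or.inr (Or.inr h)
      · simp only [List.length_cons] at h7
        omega
    · push Not at hpush
      obtain ⟨u, hu⟩ : U.Nonempty := Finset.card_pos.1 (by omega)
      cases l with
      | nil => simpa using hpush u hu
      | cons y l =>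
        have hy := hl y List.mem_cons_self
        have hc : (insert y D).card = D.card + 1 := Finset.card_insert_of_notMem hy.2
        obtain ⟨U', D', l', h1, h2, h3, h4, h5, h6, h7⟩ :=
          ih (2 * U.card + l.length) (by simp only [List.length_cons] at hN; omega)
            U (insert y D) l rfl (List.nodup_cons.1 hnd).2 (List.isChain_cons.1 hch).2
            (Finset.disjoint_insert_right.2 ⟨hy.1, hUD⟩)
            (by
              intro x hx
              refine ⟨(hl x (List.mem_cons_of_mem _ hx)).1, fun h => ?_⟩
              rcases Finset.mem_insert.1 h with rfl | h
              · exact (List.nodup_cons.1 hnd).1 hx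
              · exact (hl x (List.mem_cons_of_mem _ hx)).2 h)
            (by
              intro a ha b hb
              rcases Finset.mem_insert.1 hb with rfl | hb
              · obtain ⟨x, hx, hax⟩ := hpush a ha
                rw [List.head?_cons, Option.mem_some_iff] at hx
                subst hx
                exact hax
              · exact hno a ha b hb) (by omega)
        refine ⟨U', D', l', h1, h2, h3, fun x hx => ?_, h5, h6, ?_⟩
        · rcases h4 x hx with h | h | h
          · exact Or.inl h
          · rcases Finset.mem_insert.1 h with rfl | h
            · exact Or.inr (Or.inr List.mem_cons_self)
            · exact Or.inr (Or.inl h)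
          · exact Or.inr (Or.inr (List.mem_cons_of_mem _ h))
        · simp only [List.length_cons]
          omega

/-- In a vertex set `W` there are paths on any number `s` of vertices up to `|W| - 2 (m - 1)`. -/
theorem IsJoined.exists_hasPathIn {m s : ℕ} (hG : G.IsJoined m) (W : Finset V) (hs : 1 ≤ s)
    (hW : s + 2 * m ≤ W.card + 2) :
    ∃ u v, G.HasPathIn W (s - 1) u v := by
  classical
  obtain ⟨U, D, l, hnd, hch, hUD, hsub, hno, heq, hcard⟩ :=
    exists_list_of_no_edges (G := G) _ W ∅ [] rfl (by simp) (by simp) (by simp) (by simp)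
      (by simp) (by simp)
  have hlt : U.card < m := by
    by_contra! h
    obtain ⟨a, ha, b, hb, hab⟩ := hG U D hUD h (heq ▸ h)
    exact hno a ha b hb hab
  simp only [Finset.card_empty, List.length_nil] at hcard
  have hlen : (l.take s).length = s := by
    rw [List.length_take]
    omega
  have hne : l.take s ≠ [] := by
    intro h
    rw [h, List.length_nil] at hlen
    omega
  refine ⟨_, _, Walk.ofSupport (l.take s) hne (hch.take s), ?_, ?_, ?_⟩
  · rw [Walk.isPath_def, Walk.support_ofSupport]
    exact hnd.sublist (List.take_sublist _ _)
  · rw [Walk.length_ofSupport, hlen]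
  · intro x hx
    rw [Walk.support_ofSupport] at hx
    simpa using hsub x (Or.inr (Or.inr (List.mem_of_mem_take hx)))

/-- If single vertices are joined, the graph is complete and has cycles of all lengths. -/
theorem IsJoined.hasCycleOfLength_of_one [Fintype V] (hG : G.IsJoined 1) {l : ℕ} (hl : 3 ≤ l)
    (hn : l ≤ Fintype.card V) : G.HasCycleOfLength l := by
  obtain ⟨u, v, h⟩ := hG.exists_hasPathIn (s := l) Finset.univ (by omega)
    (by rw [Finset.card_univ]; omega)
  have huv : v ≠ u := by
    rintro rfl
    obtain ⟨p, hp, hpl, -⟩ := h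
    have := Walk.length_eq_zero_iff.2 (Walk.isPath_iff_nil.1 hp)
    omega
  obtain ⟨a, ha, b, hb, hab⟩ := hG {v} {u} (by simpa using huv) (by simp) (by simp)
  rw [Finset.mem_singleton] at ha hb
  subst ha hb
  have := h.hasCycleOfLength hab (by omega)
  rwa [Nat.sub_add_cancel (by omega)] at this

/-! ### Expansion -/

open scoped Classical in
/-- The vertices of `R` outside `X` that have a neighbour in `X`. -/
noncomputable def outerNeighbors (G : SimpleGraph V) (R X : Finset V) : Finset V :=
  R.filter fun v => v ∉ X ∧ ∃ x ∈ X, G.Adj x v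

theorem mem_outerNeighbors {R X : Finset V} {v : V} :
    v ∈ G.outerNeighbors R X ↔ v ∈ R ∧ v ∉ X ∧ ∃ x ∈ X, G.Adj x v := by
  classical
  simp [outerNeighbors]

/-- A large vertex set contains a large set in which small sets expand. -/
theorem IsJoined.exists_expanding {m k : ℕ} (hG : G.IsJoined m) (hm : 1 ≤ m) (hk : 1 ≤ k)
    (R : Finset V) (hR : (3 * k + 1) * m ≤ R.card) :
    ∃ R' ⊆ R, m ≤ R'.card ∧
      ∀ X ⊆ R', 2 * X.card ≤ m → (2 * k - 1) * X.card ≤ (G.outerNeighbors R' X).card := by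
  classical
  -- Remove a largest badly expanding `Z`. The cap leaves room to add `m / 2` vertices once `|Z| <
  -- m`.
  let F := R.powerset.filter fun Z =>
    Z.card ≤ m - 1 + m / 2 ∧ (G.outerNeighbors R Z).card ≤ (2 * k - 1) * Z.card
  have hF : F.Nonempty := ⟨∅, by
    simp only [F, Finset.mem_filter, Finset.mem_powerset]
    simp [outerNeighbors]⟩
  obtain ⟨Z, hZF, hZmax⟩ := F.exists_max_image Finset.card hF
  simp only [F, Finset.mem_filter, Finset.mem_powerset] at hZF hZmax
  obtain ⟨hZR, hZc, hZN⟩ := hZF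
  have hkm : (3 * k + 1) * m = 3 * (k * m) + m := by ring
  have hmk : m ≤ k * m := Nat.le_mul_of_pos_left m hk
  -- Otherwise `Z` and its neighbours fill at most `2k · 3m/2 = 3km` vertices of `R`, leaving `m`
  -- vertices not joined to `Z`.
  have hZ : Z.card < m := by
    by_contra! hge
    have hsum : (G.outerNeighbors R Z).card + Z.card ≤ 3 * (k * m) := by
      calc _ ≤ (2 * k - 1) * Z.card + Z.card := by omega
        _ = k * (2 * Z.card) := by
          obtain ⟨j, rfl⟩ : ∃ j, k = j + 1 := ⟨k - 1, by omega⟩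
          rw [show 2 * (j + 1) - 1 = 2 * j + 1 by omega]
          ring
        _ ≤ k * (3 * m) := Nat.mul_le_mul_left k (by omega)
        _ = _ := by ring
    have hcard : m ≤ (R \ (G.outerNeighbors R Z ∪ Z)).card := by
      have := Finset.le_card_sdiff (G.outerNeighbors R Z ∪ Z) R
      have := Finset.card_union_le (G.outerNeighbors R Z) Z
      omega
    obtain ⟨a, ha, b, hb, hab⟩ := hG Z (R \ (G.outerNeighbors R Z ∪ Z))
      (Finset.disjoint_left.2 fun x hx hx' => by simp [hx] at hx') hge hcard
    simp only [Finset.mem_sdiff, Finset.mem_union, mem_outerNeighbors, not_or] at hb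
    exact hb.2.1 ⟨hb.1, hb.2.2, a, ha, hab⟩
  refine ⟨R \ Z, Finset.sdiff_subset, ?_, fun X hX hXm => ?_⟩
  · have := Finset.le_card_sdiff Z R
    omega
  -- A badly expanding `X` could be added to `Z`, against maximality.
  by_contra! hlt
  have hXpos : 0 < X.card := by
    rcases Nat.eq_zero_or_pos X.card with h | h
    · rw [h] at hlt
      omega
    · exact h
  have hdisj : Disjoint Z X :=
    Finset.disjoint_left.2 fun x hx hx' => (Finset.mem_sdiff.1 (hX hx')).2 hx
  have hcard : (Z ∪ X).card = Z.card + X.card := Finset.card_union_of_disjoint hdisj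
  have hsub : G.outerNeighbors R (Z ∪ X) ⊆
      G.outerNeighbors R Z ∪ G.outerNeighbors (R \ Z) X := by
    intro v hv
    simp only [Finset.mem_union, mem_outerNeighbors, Finset.mem_sdiff, not_or] at hv ⊢
    obtain ⟨hvR, ⟨hvZ, hvX⟩, x, hx | hx, hxv⟩ := hv
    · exact Or.inl ⟨hvR, hvZ, x, hx, hxv⟩
    · exact Or.inr ⟨⟨hvR, hvZ⟩, hvX, x, hx, hxv⟩
  have h1 := hZmax (Z ∪ X) ⟨Finset.union_subset hZR (hX.trans Finset.sdiff_subset), by omega, by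
    have h2 := Finset.card_le_card hsub
    have h3 := Finset.card_union_le (G.outerNeighbors R Z) (G.outerNeighbors (R \ Z) X)
    rw [hcard, mul_add]
    omega⟩
  omega

/-! ### Trees with many leaves -/

/-- `L` is the set of end vertices of paths of length `d` from `u` inside `T`, and makes up more
than half of `T`. -/
def IsReachedIn (G : SimpleGraph V) (R T L : Finset V) (d : ℕ) (u : V) : Prop :=
  T ⊆ R ∧ L ⊆ T ∧ T.card + 1 ≤ 2 * L.card ∧ ∀ y ∈ L, G.HasPathIn T d u y

/-- Since `|T \ L| < |L|`, at least `(2k-2)|L| + 1 ≥ k|L| + (k-1)` neighbours of `L` avoid `T`; any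
`a` of them form the new level. The condition `2|L| ≤ a` keeps that level more than half of the
tree. -/
theorem IsReachedIn.exists_succ {R T L : Finset V} {d m k a : ℕ} {u : V}
    (h : G.IsReachedIn R T L d u)
    (hR : ∀ X ⊆ R, 2 * X.card ≤ m → (2 * k - 1) * X.card ≤ (G.outerNeighbors R X).card)
    (hk : 2 ≤ k) (ham : a ≤ m) (hLa : 2 * L.card ≤ a) (haL : a ≤ k * L.card + (k - 1)) :
    ∃ T' L', L'.card = a ∧ G.IsReachedIn R T' L' (d + 1) u := by
  classical
  obtain ⟨hTR, hLT, hTL, hpath⟩ := h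
  have hexp := hR L (hLT.trans hTR) (by omega)
  have hsd : (T \ L).card = T.card - L.card := Finset.card_sdiff_of_subset hLT
  have hle : a ≤ (G.outerNeighbors R L \ (T \ L)).card := by
    have h1 := Finset.le_card_sdiff (T \ L) (G.outerNeighbors R L)
    have h2 : k * L.card + (k - 1) + L.card ≤ (2 * k - 1) * L.card + 1 := by
      obtain ⟨j, rfl⟩ : ∃ j, k = j + 2 := ⟨k - 2, by omega⟩
      obtain ⟨c, hc⟩ : ∃ c, L.card = c + 1 := ⟨L.card - 1, by omega⟩
      rw [hc, show 2 * (j + 2) - 1 = 2 * j + 3 by omega, show j + 2 - 1 = j + 1 by omega]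
      nlinarith [Nat.zero_le (j * c)]
    omega
  obtain ⟨L', hL', hL'a⟩ := Finset.exists_subset_card_eq hle
  have hmem : ∀ y ∈ L', y ∈ R ∧ y ∉ T ∧ ∃ x ∈ L, G.Adj x y := by
    intro y hy
    have := hL' hy
    simp only [Finset.mem_sdiff, mem_outerNeighbors, not_and, not_not] at this
    obtain ⟨⟨hyR, hyL, hx⟩, hyT⟩ := this
    exact ⟨hyR, fun hT => hyL (hyT hT), hx⟩
  refine ⟨T ∪ L', L', hL'a, ?_, Finset.subset_union_right, ?_, fun y hy => ?_⟩
  · exact Finset.union_subset hTR fun y hy => (hmem y hy).1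
  · have := Finset.card_union_le T L'
    omega
  · obtain ⟨-, hyT, x, hx, hxy⟩ := hmem y hy
    have hdisj : Disjoint T {y} := Finset.disjoint_singleton_right.2 hyT
    exact ((hpath x hx).append hxy (HasPathIn.refl (Finset.mem_singleton_self y)) hdisj).mono
      (Finset.union_subset_union_right (Finset.singleton_subset_iff.2 hy))

/-- In an expanding set, every vertex reaches `a` vertices by paths of a common length, which is
logarithmic in `a`. -/
theorem exists_isReachedIn {R : Finset V} {m k : ℕ} (hk : 2 ≤ k)
    (hR : ∀ X ⊆ R, 2 * X.card ≤ m → (2 * k - 1) * X.card ≤ (G.outerNeighbors R X).card)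
    (a : ℕ) (ha : 1 ≤ a) (ham : a ≤ m) :
    ∃ d ≤ Nat.log k a + 1, ∀ u ∈ R, ∃ T L, L.card = a ∧ G.IsReachedIn R T L d u := by
  induction a using Nat.strong_induction_on with
  | _ a ih =>
    have hone : ∀ u ∈ R, G.IsReachedIn R {u} {u} 0 u := fun u hu =>
      ⟨by simpa using hu, subset_rfl, by simp, fun y hy => by
        rw [Finset.mem_singleton] at hy
        subst hy
        exact HasPathIn.refl (Finset.mem_singleton_self y)⟩
    rcases lt_or_ge a k with hak | hka
    · rcases ha.eq_or_lt with rfl | ha2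
      · exact ⟨0, Nat.zero_le _, fun u hu => ⟨{u}, {u}, by simp, hone u hu⟩⟩
      · refine ⟨1, by omega, fun u hu => ?_⟩
        exact (hone u hu).exists_succ hR hk ham (by simp; omega) (by simp; omega)
    · have hlt : a / k < a := Nat.div_lt_self ha hk
      have hpos : 1 ≤ a / k := (Nat.one_le_div_iff (by omega)).2 hka
      have hdiv : k * (a / k) ≤ a := Nat.mul_div_le a k
      have htwo : 2 * (a / k) ≤ k * (a / k) := Nat.mul_le_mul_right _ hk
      have hmod : k * (a / k) + a % k = a := Nat.div_add_mod a k
      have hmodlt : a % k < k := Nat.mod_lt a (by omega)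
      -- Level sizes are the iterated quotients of `a` by `k`; the remainder, at most `k - 1`, fits
      -- the slack in `IsReachedIn.exists_succ`.
      obtain ⟨d, hd, hreach⟩ := ih (a / k) hlt hpos (by omega)
      refine ⟨d + 1, ?_, fun u hu => ?_⟩
      · rw [Nat.log_of_one_lt_of_le hk hka]
        omega
      · obtain ⟨T, L, hLc, hTL⟩ := hreach u hu
        refine hTL.exists_succ hR hk ham ?_ ?_ <;> rw [hLc] <;> omega

/-! ### Assembling the cycle -/

theorem IsJoined.card_filter_lt {m : ℕ} (hG : G.IsJoined m) (W R : Finset V)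
    (hWR : Disjoint W R) (hR : m ≤ R.card) [DecidablePred fun v => ∀ r ∈ R, ¬ G.Adj v r] :
    (W.filter fun v => ∀ r ∈ R, ¬ G.Adj v r).card < m := by
  by_contra! h
  obtain ⟨a, ha, b, hb, hab⟩ := hG _ R (hWR.mono_left (Finset.filter_subset _ _)) h hR
  exact (Finset.mem_filter.1 ha).2 b hb hab

/-- Cycles of prescribed length: a path of suitable length whose end vertices are attached to two
trees with many leaves each. -/
theorem IsJoined.hasCycleOfLength [Fintype V] {m k l : ℕ} (hG : G.IsJoined m) (hm : 1 ≤ m)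
    (hk : 2 ≤ k) (hl : 2 * Nat.log k m + 5 ≤ l)
    (hn : l + (6 * k + 6) * m ≤ Fintype.card V) : G.HasCycleOfLength l := by
  classical
  -- Two reserves, plus `2m` for vertices that cannot be attached and `2m` lost in the search.
  have hexpand : (6 * k + 6) * m = 2 * ((3 * k + 1) * m) + 4 * m := by ring
  have huniv : (Finset.univ : Finset V).card = Fintype.card V := Finset.card_univ
  obtain ⟨R₁, -, hR₁⟩ := Finset.exists_subset_card_eq
    (show (3 * k + 1) * m ≤ (Finset.univ : Finset V).card by omega)
  have hcompl : (Finset.univ \ R₁).card = Fintype.card V - R₁.card := by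
    rw [Finset.card_sdiff_of_subset (Finset.subset_univ _), huniv]
  obtain ⟨R₂, hR₂s, hR₂⟩ := Finset.exists_subset_card_eq
    (show (3 * k + 1) * m ≤ (Finset.univ \ R₁).card by omega)
  have hR₁₂ : Disjoint R₁ R₂ :=
    Finset.disjoint_left.2 fun x hx hx' => (Finset.mem_sdiff.1 (hR₂s hx')).2 hx
  obtain ⟨S₁, hS₁, hS₁m, hexp₁⟩ := hG.exists_expanding hm (by omega : 1 ≤ k) R₁ hR₁.ge
  obtain ⟨S₂, hS₂, hS₂m, hexp₂⟩ := hG.exists_expanding hm (by omega : 1 ≤ k) R₂ hR₂.ge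
  obtain ⟨d₁, hd₁, htree₁⟩ := exists_isReachedIn hk hexp₁ m hm le_rfl
  obtain ⟨d₂, hd₂, htree₂⟩ := exists_isReachedIn hk hexp₂ m hm le_rfl
  let W := Finset.univ \ (R₁ ∪ R₂)
  have hW : W.card = Fintype.card V - (R₁.card + R₂.card) := by
    rw [Finset.card_sdiff_of_subset (Finset.subset_univ _), huniv,
      Finset.card_union_of_disjoint hR₁₂]
  have hWS₁ : Disjoint W S₁ := Finset.disjoint_left.2 fun x hx hx' =>
    (Finset.mem_sdiff.1 hx).2 (Finset.mem_union_left _ (hS₁ hx'))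
  have hWS₂ : Disjoint W S₂ := Finset.disjoint_left.2 fun x hx hx' =>
    (Finset.mem_sdiff.1 hx).2 (Finset.mem_union_right _ (hS₂ hx'))
  let B₁ := W.filter fun v => ∀ r ∈ S₁, ¬ G.Adj v r
  let B₂ := W.filter fun v => ∀ r ∈ S₂, ¬ G.Adj v r
  have hB₁ : B₁.card < m := hG.card_filter_lt W S₁ hWS₁ hS₁m
  have hB₂ : B₂.card < m := hG.card_filter_lt W S₂ hWS₂ hS₂m
  have hWB : W.card ≤ (W \ (B₁ ∪ B₂)).card + (B₁.card + B₂.card) := by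
    have h1 := Finset.le_card_sdiff (B₁ ∪ B₂) W
    have h2 := Finset.card_union_le B₁ B₂
    omega
  -- The two branches contribute `d₁ + 1` and `d₂ + 1` vertices; `hl` leaves at least one for this
  -- path.
  obtain ⟨x, y, hxy⟩ := hG.exists_hasPathIn (s := l - d₁ - d₂ - 2) (W \ (B₁ ∪ B₂)) (by omega)
    (by omega)
  have hgood : ∀ v ∈ W \ (B₁ ∪ B₂), (∃ r ∈ S₁, G.Adj v r) ∧ ∃ r ∈ S₂, G.Adj v r := by
    intro v hv
    simp only [Finset.mem_sdiff, Finset.mem_union, not_or, B₁, B₂, Finset.mem_filter, not_and,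
      not_forall, not_not, exists_prop] at hv
    exact ⟨hv.2.1 hv.1, hv.2.2 hv.1⟩
  obtain ⟨r₁, hr₁, hxr₁⟩ := (hgood x hxy.mem_left).1
  obtain ⟨r₂, hr₂, hyr₂⟩ := (hgood y hxy.mem_right).2
  obtain ⟨T₁, L₁, hL₁, hTS₁, hLT₁, -, hp₁⟩ := htree₁ r₁ hr₁
  obtain ⟨T₂, L₂, hL₂, hTS₂, hLT₂, -, hp₂⟩ := htree₂ r₂ hr₂
  have hSS : Disjoint S₁ S₂ := hR₁₂.mono hS₁ hS₂
  obtain ⟨a, ha, b, hb, hab⟩ := hG L₁ L₂ (hSS.mono (hLT₁.trans hTS₁) (hLT₂.trans hTS₂)) hL₁.ge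
    hL₂.ge
  have hpath₁ := ((hp₁ a ha).mono hTS₁).symm.append hxr₁.symm (hxy.mono Finset.sdiff_subset)
    hWS₁.symm
  have hpath₂ := hpath₁.append hyr₂ ((hp₂ b hb).mono hTS₂)
    (Finset.disjoint_union_left.2 ⟨hSS, hWS₂⟩)
  have hcycle := hpath₂.hasCycleOfLength hab.symm (by omega)
  rwa [show d₁ + 1 + (l - d₁ - d₂ - 2 - 1) + 1 + d₂ + 1 = l by omega] at hcycle

end SimpleGraph

/-! ### Choice of constants -/

namespace SimpleGraph

variable {V : Type*} [Fintype V] {G : SimpleGraph V} {β : ℝ}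

theorem IsBetaGraph.isJoined_ceil (hG : G.IsBetaGraph β) :
    G.IsJoined ⌈β * (Fintype.card V : ℝ)⌉₊ := fun A B hAB hA hB =>
  hG A B hAB (Nat.ceil_le.1 hA) (Nat.ceil_le.1 hB)

theorem natLog_mul_log_le {k m n : ℕ} (hm : 1 ≤ m) (hmn : m ≤ n) :
    (Nat.log k m : ℝ) * Real.log k ≤ Real.log n := by
  rcases Nat.eq_zero_or_pos k with rfl | hk
  · simpa using Real.log_natCast_nonneg n
  · rw [← Real.log_pow]
    apply Real.log_le_log (by positivity)
    exact_mod_cast (Nat.pow_log_le_self k (by omega)).trans hmn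

/-- Cycle lengths when `β` is close to `1 / 20`. -/
theorem IsBetaGraph.hasCycleOfLength_of_lt (hG : G.IsBetaGraph β) (hβ : 0 < β)
    (hβ' : β < 1 / 20) {l : ℕ} (hl : 3 ≤ l) (hlo : 8 * Real.log (Fintype.card V : ℝ) ≤ l)
    (hhi : (l : ℝ) ≤ (1 - 99 / 100) * (Fintype.card V : ℝ)) : G.HasCycleOfLength l := by
  set n := Fintype.card V with hn
  have hl3 : (3 : ℝ) ≤ l := by exact_mod_cast hl
  have hn300 : (300 : ℝ) ≤ n := by linarith
  have hpos : 0 < β * (n : ℝ) := by positivity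
  set m := ⌈β * (n : ℝ)⌉₊ with hmdef
  have hm1 : 1 ≤ m := Nat.ceil_pos.2 hpos
  have hm : (m : ℝ) < β * n + 1 := Nat.ceil_lt_add_one hpos.le
  have hm' : (m : ℝ) ≤ n / 20 + 1 := by nlinarith
  have hmn : m ≤ n := by
    have : (m : ℝ) ≤ n := by linarith
    exact_mod_cast this
  have hlog := natLog_mul_log_le (k := 2) hm1 hmn
  have h2 : (0.69 : ℝ) < Real.log 2 := lt_trans (by norm_num) Real.log_two_gt_d9
  have hlog5 : 5 ≤ Real.log (n : ℝ) := by
    have h256 : Real.log ((2 : ℝ) ^ 8) ≤ Real.log n :=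
      Real.log_le_log (by norm_num) (le_trans (by norm_num) hn300)
    rw [Real.log_pow] at h256
    push_cast at h256
    linarith
  refine hG.isJoined_ceil.hasCycleOfLength (k := 2) hm1 le_rfl ?_ ?_
  · have h0 : (0 : ℝ) ≤ Nat.log 2 m := Nat.cast_nonneg _
    have : ((2 * Nat.log 2 m + 5 : ℕ) : ℝ) ≤ l := by
      push_cast at hlog ⊢
      nlinarith
    exact_mod_cast this
  -- Here `18m ≤ 9n/10 + 18` and `l ≤ n/100`, which fits since `n ≥ 300`.
  · have : ((l + (6 * 2 + 6) * m : ℕ) : ℝ) ≤ n := by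
      push_cast
      linarith
    exact_mod_cast this

/-- A natural number `k` of order `β ^ (-1 / 4)`. -/
theorem exists_branching {β : ℝ} (hβ : 0 < β) (hβ' : β < 1 / 10000) :
    ∃ k : ℕ, 2 ≤ k ∧ 24 * ((k : ℝ) + 1) * β ≤ 1 ∧ Real.log (1 / β) ≤ 4 * Real.log k := by
  set t := √(√β) with ht
  have hsq : 0 < √β := Real.sqrt_pos.2 hβ
  have htpos : 0 < t := Real.sqrt_pos.2 hsq
  have ht2 : t ^ 2 = √β := Real.sq_sqrt hsq.le
  have ht4 : t ^ 4 = β := by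
    rw [show t ^ 4 = (t ^ 2) ^ 2 by ring, ht2, Real.sq_sqrt hβ.le]
  have ht10 : t < 1 / 10 := by
    by_contra! h
    have : (1 / 10 : ℝ) ^ 4 ≤ t ^ 4 := pow_le_pow_left₀ (by norm_num) h 4
    rw [ht4] at this
    norm_num at this
    linarith
  have hge : (10 : ℝ) ≤ 1 / t := by
    rw [le_div_iff₀ htpos]
    linarith
  have hceil : 1 / t ≤ (⌈1 / t⌉₊ : ℝ) := Nat.le_ceil _
  have hceil' : (⌈1 / t⌉₊ : ℝ) < 1 / t + 1 := Nat.ceil_lt_add_one (by positivity)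
  refine ⟨⌈1 / t⌉₊, ?_, ?_, ?_⟩
  · have : (2 : ℝ) ≤ (⌈1 / t⌉₊ : ℝ) := by linarith
    exact_mod_cast this
  · rw [← ht4]
    calc 24 * ((⌈1 / t⌉₊ : ℝ) + 1) * t ^ 4 ≤ 24 * (3 * (1 / t)) * t ^ 4 := by
          gcongr
          linarith
      _ = 72 * t ^ 3 := by
          field_simp
          ring
      _ ≤ 72 * (1 / 10) ^ 3 := by gcongr
      _ ≤ 1 := by norm_num
  · have : 1 / β = (1 / t) ^ 4 := by rw [div_pow, one_pow, ht4]
    rw [this, Real.log_pow]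
    push_cast
    gcongr

/-- Cycle lengths when `β` is small. -/
theorem IsBetaGraph.hasCycleOfLength_of_small (hG : G.IsBetaGraph β) (hβ : 0 < β)
    (hβ' : β < 1 / 10000) {l : ℕ} (hl : 3 ≤ l)
    (hlo : 13 / Real.log (1 / β) * Real.log (Fintype.card V : ℝ) ≤ l)
    (hhi : (l : ℝ) ≤ (1 - 36 * β) * (Fintype.card V : ℝ)) : G.HasCycleOfLength l := by
  set n := Fintype.card V with hn
  have hl3 : (3 : ℝ) ≤ l := by exact_mod_cast hl
  have hn0 : (0 : ℝ) < n := by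
    by_contra! h
    nlinarith
  have hpos : 0 < β * (n : ℝ) := by positivity
  -- For `βn ≤ 1` the graph is complete; otherwise rounding up at most doubles `βn`, whence `36β =
  -- 18 · 2β`.
  rcases le_or_gt (β * (n : ℝ)) 1 with hsmall | hbig
  · have hG1 : G.IsJoined 1 := by
      have := hG.isJoined_ceil
      rwa [show ⌈β * (Fintype.card V : ℝ)⌉₊ = 1 from
        le_antisymm (Nat.ceil_le.2 (by exact_mod_cast hsmall)) (Nat.ceil_pos.2 hpos)] at this
    refine hG1.hasCycleOfLength_of_one hl ?_
    have : (l : ℝ) ≤ n := by nlinarith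
    exact_mod_cast this
  set m := ⌈β * (n : ℝ)⌉₊ with hmdef
  have hm1 : 1 ≤ m := Nat.ceil_pos.2 hpos
  have hm : (m : ℝ) < β * n + 1 := Nat.ceil_lt_add_one hpos.le
  have hm2 : (m : ℝ) ≤ 2 * (β * n) := by linarith
  have hinv : 1 / β < n := by rwa [div_lt_iff₀ hβ, mul_comm]
  have hn4 : (10000 : ℝ) < n := by nlinarith
  have hm5 : (m : ℝ) ≤ n / 5000 := by nlinarith
  have hmn : m ≤ n := by
    have : (m : ℝ) ≤ n := by linarith
    exact_mod_cast this
  rcases le_or_gt ((n : ℝ) / 2) l with hlong | hshort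
  · refine hG.isJoined_ceil.hasCycleOfLength (k := 2) hm1 le_rfl ?_ ?_
    · have hlog : (Nat.log 2 m : ℝ) ≤ m := by exact_mod_cast Nat.log_le_self 2 m
      have : ((2 * Nat.log 2 m + 5 : ℕ) : ℝ) ≤ l := by
        push_cast
        linarith
      exact_mod_cast this
    · have : ((l + (6 * 2 + 6) * m : ℕ) : ℝ) ≤ n := by
        push_cast
        linarith
      exact_mod_cast this
  · obtain ⟨k, hk, hkβ, hklog⟩ := exists_branching hβ hβ'
    have hone : (1 : ℝ) < 1 / β := by
      rw [lt_div_iff₀ hβ]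
      linarith
    have hL : 0 < Real.log (1 / β) := Real.log_pos hone
    have hLn : Real.log (1 / β) ≤ Real.log n := Real.log_le_log (by positivity) hinv.le
    refine hG.isJoined_ceil.hasCycleOfLength hm1 hk ?_ ?_
    · have hlog := natLog_mul_log_le (k := k) hm1 hmn
      have h0 : (0 : ℝ) ≤ Nat.log k m := Nat.cast_nonneg _
      -- `13 = 2 · 4 + 5`: `log_k m` is at most `4 log n / log (1/β)`, and `1 ≤ log n / log (1/β)`.
      have : ((2 * Nat.log k m + 5 : ℕ) : ℝ) ≤ l := by
        refine le_trans ?_ hlo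
        rw [div_mul_eq_mul_div, le_div_iff₀ hL]
        push_cast
        nlinarith
      exact_mod_cast this
    · have : ((l + (6 * k + 6) * m : ℕ) : ℝ) ≤ n := by
        push_cast
        have h1 : (6 * (k : ℝ) + 6) * m ≤ (6 * (k : ℝ) + 6) * (2 * (β * n)) := by gcongr
        have h2 : 24 * ((k : ℝ) + 1) * β * n ≤ 1 * n := by gcongr
        linarith
      exact_mod_cast this

end SimpleGraph

theorem theorem3 :
    ∃ C : ℝ, 0 < C ∧
      ∀ β : ℝ, 0 < β → β < 1 / 20 →
        ∃ b₁ b₂ : ℝ, 0 < b₁ ∧ b₁ ≤ C / Real.log (1 / β) ∧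
          0 < b₂ ∧ b₂ ≤ C * β ∧ b₂ < 1 ∧
          ∀ (V : Type*) [Fintype V] (G : SimpleGraph V), G.IsBetaGraph β →
            ∀ l : ℕ, 3 ≤ l →
              b₁ * Real.log (Fintype.card V : ℝ) ≤ (l : ℝ) →
              (l : ℝ) ≤ (1 - b₂) * (Fintype.card V : ℝ) →
              G.HasCycleOfLength l := by
  -- The constant is dictated by `β ≥ 1/10000`, where `8 log (1/β)` is bounded crudely by `8 ·
  -- 9999`.
  refine ⟨100000, by norm_num, fun β hβ hβ' => ?_⟩
  have hone : (1 : ℝ) < 1 / β := by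
    rw [lt_div_iff₀ hβ]
    linarith
  have hL : 0 < Real.log (1 / β) := Real.log_pos hone
  rcases lt_or_ge β (1 / 10000) with hsmall | hlarge
  · refine ⟨13 / Real.log (1 / β), 36 * β, by positivity, ?_, by positivity, by linarith,
      by linarith, fun V _ G hG l hl hlo hhi => hG.hasCycleOfLength_of_small hβ hsmall hl hlo hhi⟩
    gcongr
    norm_num
  · refine ⟨8, 99 / 100, by norm_num, ?_, by norm_num, by linarith, by norm_num,
      fun V _ G hG l hl hlo hhi => hG.hasCycleOfLength_of_lt hβ hβ' hl hlo hhi⟩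
    have hinv : 1 / β ≤ 10000 := by
      rw [div_le_iff₀ hβ]
      linarith
    have hlog : Real.log (1 / β) ≤ 1 / β - 1 := Real.log_le_sub_one_of_pos (by positivity)
    rw [le_div_iff₀ hL]
    linarith
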